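/- Let $(X,\mathcal B,\mu)$ be a probability space and $T:X\to X$ a measurable, $\mu$-preserving map. For a strictly increasing sequence $S=\{s_1<s_2<\cdots\}$ of positive integers, let its upper dimension be $$\overline D(S)=\inf\Big\{\sigma\ge 0:\ \limsup_{n\to\infty}\frac{n}{s_n^{\sigma}}=0\Big\}.$$ For a finite measurable partition $\alpha$ of $X$, call $S$ an entropy generating sequence of $\alpha$ (for $T$) if $$\liminf_{n\to\infty}\frac1n H_\mu\Big(\bigvee_{i=1}^n T^{-s_i}\alpha\Big)>0,$$ where $H_\mu$ is Shannon entropy, and let the upper entropy dimension $\overline D_\mu(T,\alpha)$ be the supremum of $\overline D(S)$ over all entropy generating sequences $S$ of $\alpha$ (and $0$ if there are none). For $\tau\in[0,1)$ put $$P^\tau_\mu(T)=\{A\in\mathcal B:\ \overline D_\mu(T,\{A,X\setminus A\})\le\tau\}.$$ Then: 1. $P^\tau_\mu(T)$ is a sub-$\sigma$-algebra of $\mathcal B$. 2. $T^{-1}P^\tau_\mu(T)=P^\tau_\mu(T)$ mod $\mu$, i.e. for every $A\in P^\tau_\mu(T)$ there is $B\in P^\tau_\mu(T)$ with $\mu(T^{-1}A\,\triangle\,B)=0$,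 and for every $B\in P^\tau_\mu(T)$ there is $A\in P^\tau_\mu(T)$ with $\mu(B\,\triangle\,T^{-1}A)=0$. 3. For every integer $k\ge1$, $P^\tau_\mu(T)=P^\tau_\mu(T^k)$. If $T$ is invertible modulo $\mu$, i.e. there is a measurable map $T^{-1}:X\to X$ with $T^{-1}\circ T=\mathrm{id}$ and $T\circ T^{-1}=\mathrm{id}$ $\mu$-almost everywhere, then $P^\tau_\mu(T)=P^\tau_\mu(T^{-1})$. -/

import Mathlib

open MeasureTheory Filter
open scoped ENNReal NNReal

noncomputable section

namespace EntropyDim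

/-- The set of strictly increasing sequences of positive integers. The element `s n` is the
`(n+1)`-st term of the sequence `S = {s 0 < s 1 < ⋯}`. -/
def IncSeq : Set (ℕ → ℕ) := {s | StrictMono s ∧ 0 < s 0}

/-- `limsup_n n / (s_n) ^ τ` (with the sequence numbered from `1`), as an element of `[0, ∞]`. -/
def upperDensityAt (s : ℕ → ℕ) (τ : ℝ≥0) : ℝ≥0∞ :=
  limsup (fun n : ℕ => ENNReal.ofReal (((n : ℝ) + 1) / (s n : ℝ) ^ (τ : ℝ))) atTop

/-- The upper dimension of a sequence: the infimum of the `τ ≥ 0` for which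
`limsup_n n / (s_n) ^ τ = 0`. -/
def upperDim (s : ℕ → ℕ) : ℝ≥0∞ :=
  ⨅ (τ : ℝ≥0) (_ : upperDensityAt s τ = 0), (τ : ℝ≥0∞)

/-- A finite measurable partition of `X`, with cells labelled by a finite type `ι`.
Cells may be empty. -/
structure FinPartition (X : Type*) [MeasurableSpace X] (ι : Type*) [Fintype ι] where
  cell : ι → Set X
  measurableSet_cell : ∀ i, MeasurableSet (cell i)
  disjoint_cell : ∀ i j, i ≠ j → Disjoint (cell i) (cell j)
  iUnion_cell : ⋃ i, cell i = Set.univ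

/-- The partition `{A, X \ A}`. -/
def pairPartition {X : Type*} [MeasurableSpace X] (A : Set X) (hA : MeasurableSet A) :
    FinPartition X Bool where
  cell b := if b then A else Aᶜ
  measurableSet_cell b := by
    cases b
    · simpa using hA
    · simpa using hA
  disjoint_cell i j hij := by
    cases i <;> cases j <;> simp_all [disjoint_compl_right, disjoint_compl_left]
  iUnion_cell := by
    ext x
    simp only [Set.mem_iUnion, Bool.exists_bool, Set.mem_univ, iff_true]
    by_cases h : x ∈ A <;> simp [h]

variable {X : Type*} [MeasurableSpace X] {ι : Type*} [Fintype ι]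

/-- The cells of the join `T^{-s_1} α ∨ ⋯ ∨ T^{-s_n} α`, labelled by words of length `n`. -/
def joinCell (T : X → X) (α : FinPartition X ι) (s : ℕ → ℕ) (n : ℕ) (w : Fin n → ι) : Set X :=
  ⋂ i : Fin n, T^[s i] ⁻¹' α.cell (w i)

/-- The Shannon entropy `H_μ(T^{-s_1} α ∨ ⋯ ∨ T^{-s_n} α)`, that is, the sum of
`- μ(C) log μ(C)` over the cells `C`, with `0 log 0 = 0`. -/
def joinEntropy (μ : Measure X) (T : X → X) (α : FinPartition X ι) (s : ℕ → ℕ) (n : ℕ) : ℝ :=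
  ∑ w : Fin n → ι, Real.negMulLog (μ.real (joinCell T α s n w))

/-- The set of entropy generating sequences of `α`: those `S` with
`liminf_n (1 / n) H_μ(T^{-s_1} α ∨ ⋯ ∨ T^{-s_n} α) > 0`. -/
def entropyGenerating (μ : Measure X) (T : X → X) (α : FinPartition X ι) : Set (ℕ → ℕ) :=
  {s | s ∈ IncSeq ∧
    0 < liminf (fun n : ℕ => ENNReal.ofReal (joinEntropy μ T α s n / (n : ℝ))) atTop}

/-- The upper entropy dimension of `α`: the supremum of the upper dimensions of its entropy
generating sequences (`0` if there are none). -/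
def upperEntropyDim (μ : Measure X) (T : X → X) (α : FinPartition X ι) : ℝ≥0∞ :=
  ⨆ s ∈ entropyGenerating μ T α, upperDim s

/-- The collection of measurable sets `A` for which the partition `{A, X \ A}` has upper entropy
dimension at most `τ`. -/
def dimAlgebra (μ : Measure X) (T : X → X) (τ : ℝ) : Set (Set X) :=
  {A | ∃ hA : MeasurableSet A, upperEntropyDim μ T (pairPartition A hA) ≤ ENNReal.ofReal τ}

/-- A collection of sets is a sub-σ-algebra of the σ-algebra of `X`. -/
def IsSubSigmaAlgebra {X : Type*} [mX : MeasurableSpace X] (𝒜 : Set (Set X)) : Prop :=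
  ∃ P : MeasurableSpace X, P ≤ mX ∧ ∀ A : Set X, MeasurableSet[P] A ↔ A ∈ 𝒜

/-- Two collections of sets agree modulo `μ`: each member of one of them coincides up to a
`μ`-null set with a member of the other. -/
def EqMod (μ : Measure X) (𝒜 ℬ : Set (Set X)) : Prop :=
  (∀ A ∈ 𝒜, ∃ B ∈ ℬ, A =ᵐ[μ] B) ∧ (∀ B ∈ ℬ, ∃ A ∈ 𝒜, B =ᵐ[μ] A)

end EntropyDim

end

noncomputable section

namespace EntropyDim

/-! Membership in `dimAlgebra` is equivalent to a uniform finite condition, `IsSlow`: for σ > τ and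
c > 0, once N is large, every F ⊆ [1, N] has orbit entropy at most c(|F| + N^σ). A generating
sequence of upper dimension above τ violates this along its initial segments. Conversely, if the
bound fails for infinitely many N, select an index greedily whenever it raises the entropy by at
least c. The selected sequence generates entropy at rate c. A set F violating the bound has entropy
at most that of the selection in [1, N] plus c|F|, so the selection has at least a constant times
N^σ members there, and its upper dimension is at least σ.

The condition is stable under every operation needed. Replacing A by B costs |F| H(A | B), which the
term c|F| absorbs; this gives countable unions. Powers of T are handled by residue classes, and the
inverse by the reflection i ↦ N - i.

For surjectivity of T⁻¹ modulo μ, τ < 1 rules out linear entropy growth on intervals, so A is nearly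
determined by T⁻¹A, …, T⁻ⁿA. Hence A is a limit of sets T⁻¹C with C in the algebra, and
Borel–Cantelli gives A = T⁻¹(limsup C) almost everywhere. -/

/-! ### Inequalities for -x log x -/

open Real in
theorem negMulLog_sum_le {κ : Type*} (s : Finset κ) (p : κ → ℝ) (hp : ∀ k ∈ s, 0 ≤ p k) :
    negMulLog (∑ k ∈ s, p k) ≤ ∑ k ∈ s, negMulLog (p k) := by
  unfold negMulLog
  rw [neg_mul, Finset.sum_mul, ← Finset.sum_neg_distrib]
  refine Finset.sum_le_sum fun k hk => ?_
  rcases (hp k hk).eq_or_lt with h | h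
  · simp [← h]
  · have := log_le_log h (Finset.single_le_sum hp hk)
    nlinarith

open Real in
theorem negMulLog_le_one {x : ℝ} (hx : 0 ≤ x) : negMulLog x ≤ 1 := by
  rcases hx.eq_or_lt with h | h
  · simp [← h]
  · have h1 := one_sub_inv_le_log_of_pos h
    have h2 : x * (1 - x⁻¹) ≤ x * log x := mul_le_mul_of_nonneg_left h1 hx
    rw [mul_sub, mul_inv_cancel₀ h.ne'] at h2
    unfold negMulLog
    linarith

-- Nonnegativity of mutual information for unnormalised masses, whence the term in the total mass
-- `t`. It is log y ≤ y - 1 at y = q r / (p t), weighted by p and summed.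
open Real in
theorem negMulLog_submodular {α β : Type*} [Fintype α] [Fintype β] (p : α → β → ℝ)
    (hp : ∀ a b, 0 ≤ p a b) :
    ∑ a, ∑ b, negMulLog (p a b) + negMulLog (∑ a, ∑ b, p a b) ≤
      ∑ a, negMulLog (∑ b, p a b) + ∑ b, negMulLog (∑ a, p a b) := by
  set t := ∑ a, ∑ b, p a b with ht
  set q : α → ℝ := fun a => ∑ b, p a b with hq
  set r : β → ℝ := fun b => ∑ a, p a b with hr
  have hq0 : ∀ a, 0 ≤ q a := fun a => Finset.sum_nonneg fun b _ => hp a b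
  have hr0 : ∀ b, 0 ≤ r b := fun b => Finset.sum_nonneg fun a _ => hp a b
  have hqt : ∑ a, q a = t := rfl
  have hrt : ∑ b, r b = t := Finset.sum_comm
  have ht0 : 0 ≤ t := Finset.sum_nonneg fun a _ => hq0 a
  have key : ∀ a b, p a b * log (q a) + p a b * log (r b) - p a b * log (p a b) - p a b * log t ≤
      q a * r b / t - p a b := by
    intro a b
    rcases (hp a b).eq_or_lt with h | h
    · rw [← h]
      simpa using div_nonneg (mul_nonneg (hq0 a) (hr0 b)) ht0
    · have hqp : 0 < q a := h.trans_le
        (Finset.single_le_sum (fun b _ => hp a b) (Finset.mem_univ b))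
      have hrp : 0 < r b := h.trans_le
        (Finset.single_le_sum (f := fun a => p a b) (fun a _ => hp a b) (Finset.mem_univ a))
      have htp : 0 < t := hqp.trans_le (Finset.single_le_sum (fun a _ => hq0 a) (Finset.mem_univ a))
      have h1 := log_le_sub_one_of_pos (show 0 < q a * r b / (p a b * t) by positivity)
      rw [log_div (by positivity) (by positivity), log_mul hqp.ne' hrp.ne',
        log_mul h.ne' htp.ne'] at h1
      have h2 := mul_le_mul_of_nonneg_left h1 h.le
      have h3 : p a b * (q a * r b / (p a b * t) - 1) = q a * r b / t - p a b := by
        field_simp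
      linarith
  have hsum : ∑ a, ∑ b, (q a * r b / t - p a b) = 0 := by
    simp only [Finset.sum_sub_distrib]
    rw [← ht]
    simp only [mul_div_assoc, ← Finset.mul_sum, ← Finset.sum_div, hrt, ← Finset.sum_mul, hqt]
    rcases ht0.eq_or_lt with h | h
    · simp [← h]
    · field_simp; ring
  have hle := Finset.sum_le_sum fun a (_ : a ∈ Finset.univ) =>
    Finset.sum_le_sum fun b (_ : b ∈ Finset.univ) => key a b
  rw [hsum] at hle
  simp only [Finset.sum_sub_distrib, Finset.sum_add_distrib, ← Finset.sum_mul] at hle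
  have hcomm : ∑ a, ∑ b, p a b * log (r b) = ∑ b, r b * log (r b) := by
    rw [Finset.sum_comm]; simp only [← Finset.sum_mul, hr]
  rw [hcomm] at hle
  simp only [negMulLog, neg_mul, Finset.sum_neg_distrib]
  change _ ≤ -∑ a, q a * log (q a) + -∑ b, r b * log (r b)
  change ∑ a, q a * log (q a) + _ - _ - t * log t ≤ 0 at hle
  linarith

-- The smaller mass is the error of the best guess between two cells, here bounded by their entropy.
-- The estimate log y ≤ y - 1 bounds the right side below by 2pq/(p + q).
open Real in
theorem min_le_negMulLog_add {p q : ℝ} (hp : 0 ≤ p) (hq : 0 ≤ q) :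
    min p q ≤ negMulLog p + negMulLog q - negMulLog (p + q) := by
  rcases hp.eq_or_lt with h | h
  · simp [← h]
  rcases hq.eq_or_lt with h' | h'
  · simp [← h']
  have hs : 0 < p + q := by positivity
  have e1 := mul_le_mul_of_nonneg_left (log_le_sub_one_of_pos (show 0 < p / (p + q) by positivity)) hp
  have e2 := mul_le_mul_of_nonneg_left (log_le_sub_one_of_pos (show 0 < q / (p + q) by positivity)) hq
  rw [log_div h.ne' hs.ne'] at e1
  rw [log_div h'.ne' hs.ne'] at e2
  have e3 : p * (p / (p + q) - 1) + q * (q / (p + q) - 1) = - (2 * p * q / (p + q)) := by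
    field_simp; ring
  have e4 : min p q ≤ 2 * p * q / (p + q) := by
    rw [le_div_iff₀ hs]
    rcases le_total p q with hh | hh
    · rw [min_eq_left hh]; nlinarith
    · rw [min_eq_right hh]; nlinarith
  unfold negMulLog
  linarith

/-! ### Shannon entropy of finite-valued maps -/

section Entropy

variable {X : Type*} [MeasurableSpace X]

/-- Shannon entropy of a map with finitely many values. -/
def entropy (μ : Measure X) {κ : Type*} [Fintype κ] (f : X → κ) : ℝ :=
  ∑ k, Real.negMulLog (μ.real (f ⁻¹' {k}))

/-- Conditional Shannon entropy of `f` given `g`. -/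
def condEntropy (μ : Measure X) {κ ξ : Type*} [Fintype κ] [Fintype ξ] (f : X → κ) (g : X → ξ) : ℝ :=
  entropy μ (fun x => (f x, g x)) - entropy μ g

variable {μ : Measure X}

theorem measureReal_preimage_comp [IsFiniteMeasure μ] {κ ξ : Type*} [Fintype κ] [DecidableEq ξ]
    [MeasurableSpace κ] [MeasurableSingletonClass κ] {f : X → κ} (hf : Measurable f)
    (φ : κ → ξ) (l : ξ) :
    μ.real ((fun x => φ (f x)) ⁻¹' {l}) = ∑ k with φ k = l, μ.real (f ⁻¹' {k}) := by
  rw [← measureReal_biUnion_finset]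
  · congr 1
    ext x
    simp
  · intro a _ b _ hab
    exact Disjoint.preimage f (by simpa using hab)
  · exact fun b _ => hf (measurableSet_singleton b)

theorem entropy_nonneg [IsProbabilityMeasure μ] {κ : Type*} [Fintype κ] (f : X → κ) :
    0 ≤ entropy μ f :=
  Finset.sum_nonneg fun _ _ => Real.negMulLog_nonneg measureReal_nonneg measureReal_le_one

theorem entropy_le_card {κ : Type*} [Fintype κ] (f : X → κ) :
    entropy μ f ≤ Fintype.card κ := by
  refine (Finset.sum_le_card_nsmul _ _ 1 fun k _ => negMulLog_le_one measureReal_nonneg).trans ?_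
  simp

theorem entropy_congr {κ : Type*} [Fintype κ] {f g : X → κ} (h : f =ᵐ[μ] g) :
    entropy μ f = entropy μ g := by
  refine Finset.sum_congr rfl fun k _ => ?_
  rw [measureReal_congr (h.preimage {k})]

theorem entropy_comp_measurePreserving {κ : Type*} [Fintype κ] [MeasurableSpace κ]
    [MeasurableSingletonClass κ] {f : X → κ} (hf : Measurable f) {T : X → X}
    (hT : MeasurePreserving T μ μ) : entropy μ (fun x => f (T x)) = entropy μ f := by
  refine Finset.sum_congr rfl fun k _ => ?_
  rw [← hT.measureReal_preimage (hf (measurableSet_singleton k)).nullMeasurableSet]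
  rfl

theorem entropy_le_of_factor [IsFiniteMeasure μ] {κ ξ : Type*} [Fintype κ] [Fintype ξ]
    [MeasurableSpace ξ] [MeasurableSingletonClass ξ] {f : X → κ} {g : X → ξ} (hg : Measurable g) (φ : ξ → κ)(h : ∀ x, f x = φ (g x)) : entropy μ f ≤ entropy μ g := by
  classical
  obtain rfl : f = fun x => φ (g x) := funext h
  unfold entropy
  rw [← Finset.sum_fiberwise Finset.univ φ (fun k => Real.negMulLog (μ.real (g ⁻¹' {k})))]
  refine Finset.sum_le_sum fun k _ => ?_
  rw [measureReal_preimage_comp hg]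
  exact negMulLog_sum_le _ _ fun _ _ => measureReal_nonneg

variable [IsFiniteMeasure μ] {κ ξ ζ : Type*} [Fintype κ] [Fintype ξ] [Fintype ζ]
  [MeasurableSpace κ] [MeasurableSingletonClass κ]
  [MeasurableSpace ξ] [MeasurableSingletonClass ξ] [MeasurableSpace ζ] [MeasurableSingletonClass ζ]

theorem entropy_eq_of_factor {f : X → κ} {g : X → ξ} (hf : Measurable f) (hg : Measurable g)
    (φ : ξ → κ) (ψ : κ → ξ) (h : ∀ x, f x = φ (g x)) (h' : ∀ x, g x = ψ (f x)) :
    entropy μ f = entropy μ g :=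
  (entropy_le_of_factor hg φ h).antisymm (entropy_le_of_factor hf ψ h')

theorem entropy_submodular {f : X → κ} {g : X → ξ} {h : X → ζ} (hf : Measurable f)
    (hg : Measurable g) (hh : Measurable h) :
    entropy μ (fun x => (f x, g x, h x)) + entropy μ h ≤
      entropy μ (fun x => (f x, h x)) + entropy μ (fun x => (g x, h x)) := by
  classical
  set p : ζ → κ → ξ → ℝ := fun c a b => μ.real ((fun x => (f x, g x, h x)) ⁻¹' {(a, b, c)}) with hp
  have hm : Measurable (fun x => (f x, g x, h x)) := hf.prodMk (hg.prodMk hh)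
  have e1 : entropy μ (fun x => (f x, g x, h x)) = ∑ c, ∑ a, ∑ b, Real.negMulLog (p c a b) := by
    have h1 : ∀ a, ∑ b, ∑ c, Real.negMulLog (p c a b) = ∑ c, ∑ b, Real.negMulLog (p c a b) :=
      fun a => Finset.sum_comm
    simp only [entropy, Fintype.sum_prod_type]
    rw [Finset.sum_comm (s := Finset.univ (α := ζ))]
    exact Finset.sum_congr rfl fun a _ => h1 a
  have m1 : ∀ a c, μ.real ((fun x => (f x, h x)) ⁻¹' {(a, c)}) = ∑ b, p c a b := by
    intro a c
    rw [measureReal_preimage_comp hm (fun y => (y.1, y.2.2)) (a, c)]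
    refine (Finset.sum_nbij (fun b => (a, b, c)) ?_ ?_ ?_ ?_).symm
    · simp
    · intro b _ b' _ h; simpa using h
    · rintro ⟨a', b, c'⟩ h
      simp only [Finset.coe_filter, Finset.mem_univ, true_and, Set.mem_ofPred_eq,
        Prod.mk.injEq] at h
      exact ⟨b, by simp, by simp [h.1, h.2]⟩
    · intro b _; rfl
  have m2 : ∀ b c, μ.real ((fun x => (g x, h x)) ⁻¹' {(b, c)}) = ∑ a, p c a b := by
    intro b c
    rw [measureReal_preimage_comp hm (fun y => y.2) (b, c)]
    refine (Finset.sum_nbij (fun a => (a, b, c)) ?_ ?_ ?_ ?_).symm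
    · simp
    · intro b _ b' _ h; simpa using h
    · rintro ⟨a', b', c'⟩ h
      simp only [Finset.coe_filter, Finset.mem_univ, true_and, Set.mem_ofPred_eq,
        Prod.mk.injEq] at h
      exact ⟨a', by simp, by simp [h.1, h.2]⟩
    · intro b _; rfl
  have m3 : ∀ c, μ.real (h ⁻¹' {c}) = ∑ a, ∑ b, p c a b := by
    intro c
    have := measureReal_preimage_comp (μ := μ) (hf.prodMk hh) (fun y => y.2) c
    rw [this]
    simp only [← m1]
    refine (Finset.sum_nbij (fun a => (a, c)) ?_ ?_ ?_ ?_).symm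
    · simp
    · intro b _ b' _ h; simpa using h
    · rintro ⟨a', c'⟩ h
      simp only [Finset.coe_filter, Finset.mem_univ, true_and, Set.mem_ofPred_eq] at h
      exact ⟨a', by simp, by simp [h]⟩
    · intro b _; rfl
  have e2 : entropy μ (fun x => (f x, h x)) = ∑ c, ∑ a, Real.negMulLog (∑ b, p c a b) := by
    unfold entropy
    rw [Fintype.sum_prod_type_right]
    simp only [m1]
  have e3 : entropy μ (fun x => (g x, h x)) = ∑ c, ∑ b, Real.negMulLog (∑ a, p c a b) := by
    unfold entropy
    rw [Fintype.sum_prod_type_right]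
    simp only [m2]
  have e4 : entropy μ h = ∑ c, Real.negMulLog (∑ a, ∑ b, p c a b) := by
    unfold entropy
    simp only [m3]
  rw [e1, e2, e3, e4, ← Finset.sum_add_distrib, ← Finset.sum_add_distrib]
  exact Finset.sum_le_sum fun c _ => negMulLog_submodular _ fun _ _ => measureReal_nonneg

/-- Conditioning on more information lowers entropy: this is submodularity, with the pair (g, h)
carrying no more than g. -/
theorem condEntropy_le_of_factor {f : X → κ} {g : X → ξ} {h : X → ζ} (hf : Measurable f)
    (hg : Measurable g) (hh : Measurable h) (φ : ξ → ζ) (hφ : ∀ x, h x = φ (g x)) :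
    condEntropy μ f g ≤ condEntropy μ f h := by
  have h1 := entropy_submodular (μ := μ) hf hg hh
  have h2 : entropy μ (fun x => (g x, h x)) = entropy μ g :=
    entropy_eq_of_factor (hg.prodMk hh) hg (fun y => (y, φ y)) Prod.fst
      (fun x => by simp [hφ]) fun x => rfl
  have h3 : entropy μ (fun x => (f x, g x)) ≤ entropy μ (fun x => (f x, g x, h x)) :=
    entropy_le_of_factor (hf.prodMk (hg.prodMk hh)) (fun y => (y.1, y.2.1)) fun x => rfl
  unfold condEntropy
  linarith

theorem entropy_le_add_condEntropy {f : X → κ} {g : X → ξ} (hf : Measurable f)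
    (hg : Measurable g) : entropy μ f ≤ entropy μ g + condEntropy μ f g := by
  have : entropy μ f ≤ entropy μ (fun x => (f x, g x)) :=
    entropy_le_of_factor (hf.prodMk hg) Prod.fst fun x => rfl
  unfold condEntropy
  linarith

end Entropy

theorem condEntropy_le_entropy {X : Type*} [MeasurableSpace X] {μ : Measure X}
    [IsProbabilityMeasure μ] {κ ξ : Type*} [Fintype κ] [Fintype ξ]
    [MeasurableSpace κ] [MeasurableSingletonClass κ]
    [MeasurableSpace ξ] [MeasurableSingletonClass ξ] {f : X → κ} {g : X → ξ} (hf : Measurable f)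
    (hg : Measurable g) : condEntropy μ f g ≤ entropy μ f := by
  have h1 : condEntropy μ f g ≤ condEntropy μ f (fun _ => ()) :=
    condEntropy_le_of_factor hf hg measurable_const (fun _ => ()) fun _ => rfl
  have h2 : entropy μ (fun x => (f x, ())) = entropy μ f :=
    entropy_eq_of_factor (hf.prodMk measurable_const) hf (fun y => (y, ())) Prod.fst
      (fun _ => rfl) fun _ => rfl
  have h3 := entropy_nonneg (μ := μ) (fun _ : X => ())
  unfold condEntropy at *
  linarith

/-! ### Joint entropy of finite subfamilies -/

section Joint

variable {X : Type*} [MeasurableSpace X] {I J : Type*}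

/-- The joint map of the members of a family indexed by a finite set. -/
def jointMap {κ : Type*} (f : I → X → κ) (F : Finset I) (x : X) (i : F) : κ := f i x

/-- The Shannon entropy of the joint map of the members of a family indexed by a finite set. -/
def jointEntropy (μ : Measure X) {κ : Type*} [Fintype κ] (f : I → X → κ) (F : Finset I) : ℝ := by
  classical exact entropy μ (jointMap f F)

theorem measurable_jointMap {κ : Type*} [MeasurableSpace κ] {f : I → X → κ} (hf : ∀ i, Measurable (f i)) (F : Finset I) :
    Measurable (jointMap f F) :=
  measurable_pi_lambda _ fun i => hf i

variable {μ : Measure X} {κ ξ : Type*} [Fintype κ]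

theorem jointEntropy_eq [DecidableEq I] (f : I → X → κ) (F : Finset I) :
    jointEntropy μ f F = entropy μ (jointMap f F) := by
  unfold jointEntropy entropy
  congr!

variable [IsProbabilityMeasure μ]

theorem jointEntropy_empty (f : I → X → κ) : jointEntropy μ f ∅ = 0 := by
  classical
  rw [jointEntropy_eq, entropy, Fintype.sum_unique,
    show jointMap f ∅ ⁻¹' {default} = Set.univ from Set.eq_univ_of_forall fun x =>
      Subsingleton.elim _ _]
  simp

variable [MeasurableSpace κ] [MeasurableSingletonClass κ]
  [Fintype ξ] [MeasurableSpace ξ] [MeasurableSingletonClass ξ]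

theorem jointEntropy_mono {f : I → X → κ} (hf : ∀ i, Measurable (f i)) {F G : Finset I}
    (h : F ⊆ G) : jointEntropy μ f F ≤ jointEntropy μ f G := by
  classical
  rw [jointEntropy_eq, jointEntropy_eq]
  exact entropy_le_of_factor (measurable_jointMap hf G) (fun y i => y ⟨i, h i.2⟩) fun x => rfl

theorem jointEntropy_image [DecidableEq I] {f : I → X → κ} (hf : ∀ i, Measurable (f i))
    (e : J → I) (F : Finset J) :
    jointEntropy μ f (F.image e) = jointEntropy μ (fun j => f (e j)) F := by
  classical
  rw [jointEntropy_eq, jointEntropy_eq]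
  have hs : ∀ i : F.image e, ∃ j ∈ F, e j = i := fun i => Finset.mem_image.1 i.2
  choose s hsF hse using hs
  refine entropy_eq_of_factor (measurable_jointMap hf _) (measurable_jointMap (fun j => hf (e j)) _)
    (fun y i => y ⟨s i, hsF i⟩) (fun y j => y ⟨e j, Finset.mem_image_of_mem e j.2⟩) (fun x => ?_)
    fun x => rfl
  funext i
  simp [jointMap, hse]

theorem condEntropy_jointMap_le [DecidableEq I] {f : I → X → κ} (hf : ∀ i, Measurable (f i))
    {g : X → ξ} (hg : Measurable g) (F : Finset I) :
    condEntropy μ (jointMap f F) g ≤ ∑ i ∈ F, condEntropy μ (f i) g := by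
  induction F using Finset.induction_on with
  | empty =>
    have : entropy μ (fun x => (jointMap f ∅ x, g x)) = entropy μ g :=
      entropy_eq_of_factor ((measurable_jointMap hf _).prodMk hg) hg (fun y => (default, y))
        Prod.snd (fun x => Prod.ext (Subsingleton.elim _ _) rfl) fun x => rfl
    simp [condEntropy, this]
  | insert a F ha ih =>
    rw [Finset.sum_insert ha]
    have hF := measurable_jointMap hf F
    have h1 : condEntropy μ (f a) (fun x => (jointMap f F x, g x)) ≤ condEntropy μ (f a) g :=
      condEntropy_le_of_factor (hf a) (hF.prodMk hg) hg Prod.snd fun x => rfl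
    have h2 : entropy μ (fun x => (jointMap f (insert a F) x, g x)) ≤
        entropy μ (fun x => (f a x, jointMap f F x, g x)) := by
      refine entropy_le_of_factor ((hf a).prodMk (hF.prodMk hg))
        (fun y => (fun i => if h : (i : I) ∈ F then y.2.1 ⟨i, h⟩ else y.1, y.2.2)) fun x => ?_
      refine Prod.ext (funext fun i => ?_) rfl
      by_cases h : (i : I) ∈ F
      · simp [h, jointMap]
      · have : (i : I) = a := (Finset.mem_insert.1 i.2).resolve_right h
        simp [jointMap, this, ha]
    unfold condEntropy at *
    linarith

theorem jointEntropy_le_add_sum [DecidableEq I] {f : I → X → κ} (hf : ∀ i, Measurable (f i))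
    {g : X → ξ} (hg : Measurable g) (F : Finset I) :
    jointEntropy μ f F ≤ entropy μ g + ∑ i ∈ F, condEntropy μ (f i) g := by
  rw [jointEntropy_eq]
  have h1 := entropy_le_add_condEntropy (μ := μ) (measurable_jointMap hf F) hg
  have h2 := condEntropy_jointMap_le (μ := μ) hf hg F
  linarith

/-- Identifies the increment tested by the greedy selection as a conditional entropy. -/
theorem condEntropy_jointMap_eq [DecidableEq I] {f : I → X → κ} (hf : ∀ i, Measurable (f i))
    (a : I) (F : Finset I) :
    condEntropy μ (f a) (jointMap f F) = jointEntropy μ f (insert a F) - jointEntropy μ f F := by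
  rw [jointEntropy_eq, jointEntropy_eq, condEntropy]
  congr 1
  refine entropy_eq_of_factor ((hf a).prodMk (measurable_jointMap hf F)) (measurable_jointMap hf _)
    (fun y => (y ⟨a, Finset.mem_insert_self a F⟩, fun i => y ⟨i, Finset.mem_insert_of_mem i.2⟩))
    (fun y i => if h : (i : I) ∈ F then y.2 ⟨i, h⟩ else y.1) (fun x => rfl) fun x => ?_
  funext i
  by_cases h : (i : I) ∈ F
  · simp [h, jointMap]
  · have : (i : I) = a := (Finset.mem_insert.1 i.2).resolve_right h
    by_cases h' : a ∈ F <;> simp [jointMap, this, h']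

theorem jointEntropy_le_card_mul {f : I → X → κ} (hf : ∀ i, Measurable (f i)) (F : Finset I) :
    jointEntropy μ f F ≤ F.card * Fintype.card κ := by
  classical
  have h1 := jointEntropy_le_add_sum (μ := μ) hf (measurable_const (a := ())) F
  have h2 : entropy μ (fun _ : X => ()) = 0 := by simp [entropy, Set.preimage]
  have h3 : ∑ i ∈ F, condEntropy μ (f i) (fun _ : X => ()) ≤ F.card • (Fintype.card κ : ℝ) :=
    Finset.sum_le_card_nsmul _ _ _ fun i _ =>
      (condEntropy_le_entropy (hf i) measurable_const).trans (entropy_le_card _)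
  rw [nsmul_eq_mul] at h3
  linarith

theorem jointEntropy_union_le [DecidableEq I] {f : I → X → κ} (hf : ∀ i, Measurable (f i))
    (F G : Finset I) :
    jointEntropy μ f (F ∪ G) ≤ jointEntropy μ f F + jointEntropy μ f G := by
  have hF := measurable_jointMap hf F
  have hG := measurable_jointMap hf G
  have h1 : entropy μ (jointMap f (F ∪ G)) ≤
      entropy μ (fun x => (jointMap f F x, jointMap f G x)) := by
    refine entropy_le_of_factor (hF.prodMk hG)
      (fun y i => if h : (i : I) ∈ F then y.1 ⟨i, h⟩ else y.2 ⟨i,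
        (Finset.mem_union.1 i.2).resolve_left h⟩) fun x => ?_
    funext i
    by_cases h : (i : I) ∈ F <;> simp [h, jointMap]
  have h2 := condEntropy_le_entropy (μ := μ) hF hG
  simp only [jointEntropy_eq]
  unfold condEntropy at h2
  linarith

theorem jointEntropy_biUnion_le [DecidableEq I] {f : I → X → κ} (hf : ∀ i, Measurable (f i))
    (t : Finset J) (F : J → Finset I) :
    jointEntropy μ f (t.biUnion F) ≤ ∑ j ∈ t, jointEntropy μ f (F j) := by
  classical
  induction t using Finset.induction_on with
  | empty => simp [jointEntropy_empty]
  | insert a t ha ih =>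
    rw [Finset.biUnion_insert, Finset.sum_insert ha]
    exact (jointEntropy_union_le hf _ _).trans (by linarith)

end Joint

/-! ### Entropy along sets of times -/

section Orbit

/-- The indicator of a set, with values in `Bool`. -/
def label {X : Type*} (A : Set X) (x : X) : Bool := by classical exact decide (x ∈ A)

@[simp] theorem label_eq_true {X : Type*} {A : Set X} {x : X} : label A x = true ↔ x ∈ A := by simp [label]

@[simp] theorem label_eq_false {X : Type*} {A : Set X} {x : X} : label A x = false ↔ x ∉ A := by simp [label]

variable {X : Type*} [MeasurableSpace X]

theorem measurable_label {A : Set X} (hA : MeasurableSet A) : Measurable (label A) :=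
  measurable_to_bool (by convert hA using 1; ext x; simp)

/-- The entropy of the partition generated by the sets `T^{-i} A`, `i ∈ F`. -/
def orbitEntropy (μ : Measure X) (T : X → X) (A : Set X) (F : Finset ℕ) : ℝ :=
  jointEntropy μ (fun i x => label A (T^[i] x)) F

/-- The entropy of `T^{-i} A`, `i ∈ F`, is sublinear in the cardinality of `F`, uniformly
over the sets `F` in `[1, N]` with many more than `N ^ τ` elements. -/
def IsSlow (μ : Measure X) (T : X → X) (A : Set X) (τ : ℝ) : Prop :=
  ∀ σ > τ, ∀ c > 0, ∀ᶠ N : ℕ in atTop, ∀ F ⊆ Finset.Icc 1 N,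
    orbitEntropy μ T A F ≤ c * (F.card + (N : ℝ) ^ σ)

variable {μ : Measure X} [IsProbabilityMeasure μ] {T : X → X} {A B : Set X}

theorem measurable_label_iterate (hT : Measurable T) (hA : MeasurableSet A) (i : ℕ) :
    Measurable fun x => label A (T^[i] x) :=
  (measurable_label hA).comp (hT.iterate i)

theorem joinEntropy_eq_orbitEntropy (hT : Measurable T) (hA : MeasurableSet A) (s : ℕ → ℕ)
    (n : ℕ) : joinEntropy μ T (pairPartition A hA) s n =
      orbitEntropy μ T A ((Finset.range n).image s) := by
  have hm := measurable_label_iterate hT hA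
  have h1 : joinEntropy μ T (pairPartition A hA) s n =
      entropy μ (fun x (i : Fin n) => label A (T^[s i] x)) := by
    unfold joinEntropy entropy
    refine Finset.sum_congr rfl fun w _ => ?_
    congr 2
    ext x
    simp only [joinCell, pairPartition, Set.mem_iInter, Set.mem_preimage, Set.mem_singleton_iff,
      funext_iff]
    refine forall_congr' fun i => ?_
    cases w i <;> simp
  rw [h1, orbitEntropy, jointEntropy_image hm, jointEntropy_eq]
  exact entropy_eq_of_factor (measurable_pi_lambda _ fun i => hm (s i))
    (measurable_jointMap (fun i => hm (s i)) _)
    (fun y i => y ⟨i, Finset.mem_range.2 i.2⟩) (fun y i => y ⟨i, Finset.mem_range.1 i.2⟩)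
    (fun x => rfl) fun x => rfl

theorem orbitEntropy_image_add (hT : MeasurePreserving T μ μ) (hA : MeasurableSet A)
    (r : ℕ) (F : Finset ℕ) :
    orbitEntropy μ T A (F.image (· + r)) = orbitEntropy μ T A F := by
  have hm := measurable_label_iterate hT.measurable hA
  rw [orbitEntropy, jointEntropy_image hm, jointEntropy_eq, orbitEntropy, jointEntropy_eq,
    ← entropy_comp_measurePreserving (measurable_jointMap hm F) (hT.iterate r)]
  congr 1
  funext x i
  simp [jointMap, Function.iterate_add_apply]

end Orbit

/-! ### Greedy selection of indices -/

section Greedy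

/-- The elements `1 ≤ i ≤ n` that are selected if, in turn, an index is selected when it
increases the value of `E` on the set of selected indices by at least `d`. -/
def greedy (E : Finset ℕ → ℝ) (d : ℝ) : ℕ → Finset ℕ := by
  classical exact fun n => n.rec ∅ fun n A =>
    if d ≤ E (insert (n + 1) A) - E A then insert (n + 1) A else A

theorem greedy_succ (E : Finset ℕ → ℝ) (d : ℝ) (n : ℕ) : greedy E d (n + 1) =
    if d ≤ E (insert (n + 1) (greedy E d n)) - E (greedy E d n) then
      insert (n + 1) (greedy E d n) else greedy E d n := by
  unfold greedy
  simp only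

theorem greedy_subset_succ (E : Finset ℕ → ℝ) (d : ℝ) (n : ℕ) :
    greedy E d n ⊆ greedy E d (n + 1) := by
  rw [greedy_succ]
  split_ifs
  · exact Finset.subset_insert _ _
  · exact subset_rfl

theorem greedy_mono (E : Finset ℕ → ℝ) (d : ℝ) : Monotone (greedy E d) :=
  monotone_nat_of_le_succ (greedy_subset_succ E d)

theorem greedy_subset_Icc (E : Finset ℕ → ℝ) (d : ℝ) (n : ℕ) :
    greedy E d n ⊆ Finset.Icc 1 n := by
  induction n with
  | zero => exact subset_rfl
  | succ n ih =>
    have : Finset.Icc 1 n ⊆ Finset.Icc 1 (n + 1) := Finset.Icc_subset_Icc_right n.le_succ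
    rw [greedy_succ]
    split_ifs
    · exact Finset.insert_subset (by simp) (ih.trans this)
    · exact ih.trans this

/-- Decisions are never revised, so all the sets `greedy E d n` are truncations of one set of
indices. -/
theorem mem_greedy_iff (E : Finset ℕ → ℝ) (d : ℝ) {m n : ℕ} :
    m ∈ greedy E d n ↔ m ≤ n ∧ m ∈ greedy E d m := by
  induction n with
  | zero =>
    have h : greedy E d 0 = ∅ := rfl
    constructor
    · simp [h]
    · rintro ⟨h1, h2⟩
      obtain rfl := Nat.le_zero.1 h1
      exact h2
  | succ n ih =>
    constructor
    · intro h
      refine ⟨(Finset.mem_Icc.1 (greedy_subset_Icc E d _ h)).2, ?_⟩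
      rcases (Finset.mem_Icc.1 (greedy_subset_Icc E d _ h)).2.eq_or_lt with h' | h'
      · rw [h'] at h ⊢
        exact h
      · refine (ih.1 ?_).2
        rw [greedy_succ] at h
        split_ifs at h
        · exact (Finset.mem_insert.1 h).resolve_left h'.ne
        · exact h
    · exact fun h => greedy_mono E d h.1 h.2

theorem mul_card_greedy_le {E : Finset ℕ → ℝ} (h0 : E ∅ = 0) (d : ℝ) (n : ℕ) :
    d * (greedy E d n).card ≤ E (greedy E d n) := by
  induction n with
  | zero => simp [greedy, h0]
  | succ n ih =>
    rw [greedy_succ]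
    split_ifs with h
    · rw [Finset.card_insert_of_notMem fun h' => by
        have := (Finset.mem_Icc.1 (greedy_subset_Icc E d _ h')).2
        omega]
      push_cast
      linarith
    · exact ih

theorem insert_sub_le_of_notMem_greedy {E : Finset ℕ → ℝ} {d : ℝ} {n : ℕ}
    (h : n + 1 ∉ greedy E d (n + 1)) :
    E (insert (n + 1) (greedy E d n)) - E (greedy E d n) ≤ d := by
  rw [greedy_succ] at h
  split_ifs at h with h'
  · exact absurd (Finset.mem_insert_self _ _) h
  · exact (not_le.1 h').le

end Greedy

/-! ### Upper entropy dimension and the slow condition -/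

section Characterization

variable {X : Type*} [MeasurableSpace X] {μ : Measure X} [IsProbabilityMeasure μ] {T : X → X}
  {A B : Set X} {τ : ℝ}

theorem upperEntropyDim_le_of_isSlow (hT : Measurable T) (hA : MeasurableSet A)
    (h : IsSlow μ T A τ) :
    upperEntropyDim μ T (pairPartition A hA) ≤ ENNReal.ofReal τ := by
  refine iSup₂_le fun s hs => ?_
  by_contra! hlt
  obtain ⟨ρ, hτρ, hρ⟩ := ENNReal.lt_iff_exists_nnreal_btwn.1 hlt
  have hρτ : (ρ : ℝ) > τ := by
    by_contra! hle
    rw [← ENNReal.ofReal_coe_nnreal] at hτρ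
    exact absurd hτρ (not_lt.2 (ENNReal.ofReal_le_ofReal hle))
  have hd : upperDensityAt s ρ ≠ 0 := fun h0 =>
    absurd hρ (not_lt.2 (iInf₂_le ρ h0))
  obtain ⟨a, ha0, ha⟩ := ENNReal.lt_iff_exists_nnreal_btwn.1 (pos_iff_ne_zero.2 hd)
  obtain ⟨b, hb0, hb⟩ := ENNReal.lt_iff_exists_nnreal_btwn.1 hs.2
  have ha0 : (0 : ℝ) < a := by simpa using ha0
  have hb0 : (0 : ℝ) < b := by simpa using hb0
  have hfreq := frequently_lt_of_lt_limsup (by isBoundedDefault) ha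
  have hev := (tendsto_add_atTop_nat 1).eventually
    (eventually_lt_of_lt_liminf hb (by isBoundedDefault))
  have hslow := hs.1.1.tendsto_atTop.eventually
    -- With N = s n and F the first n + 1 terms, n + 1 > a N^ρ gives a(n + 1 + N^ρ) < (a + 1)(n +
    -- 1), so this constant forces entropy below b(n + 1).
    (h ρ hρτ (a * b / (a + 1)) (by positivity))
  obtain ⟨n, hn1, hn2, hn3⟩ := (hfreq.and_eventually (hev.and hslow)).exists
  have hspos : ∀ i, 1 ≤ s i := fun i => hs.1.2.trans_le (hs.1.1.monotone (Nat.zero_le i))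
  specialize hn3 ((Finset.range (n + 1)).image s) (by
    intro m hm
    obtain ⟨i, hi, rfl⟩ := Finset.mem_image.1 hm
    exact Finset.mem_Icc.2 ⟨hspos i, hs.1.1.monotone (by simpa [Nat.lt_succ_iff] using hi)⟩)
  rw [Finset.card_image_of_injective _ hs.1.1.injective, Finset.card_range] at hn3
  rw [joinEntropy_eq_orbitEntropy hT hA, ENNReal.lt_ofReal_iff_toReal_lt ENNReal.coe_ne_top,
    lt_div_iff₀ (by positivity)] at hn2
  have hsρ : (0 : ℝ) < (s n : ℝ) ^ (ρ : ℝ) := Real.rpow_pos_of_pos (by exact_mod_cast hspos n) _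
  rw [ENNReal.lt_ofReal_iff_toReal_lt ENNReal.coe_ne_top, lt_div_iff₀ hsρ] at hn1
  simp only [ENNReal.coe_toReal] at hn1 hn2
  push_cast at hn2 hn3
  rw [div_mul_eq_mul_div, le_div_iff₀ (by positivity)] at hn3
  have := mul_lt_mul_of_pos_left hn1 hb0
  nlinarith

theorem tendsto_const_mul_rpow_atTop {σ d : ℝ} (hσ : 0 < σ) (hd : 0 < d) :
    Tendsto (fun N : ℕ => d * (N : ℝ) ^ σ) atTop atTop :=
  ((tendsto_rpow_atTop hσ).comp tendsto_natCast_atTop_atTop).const_mul_atTop hd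

/-- Given the greedy set, each index of F costs at most c: nothing if it was selected; otherwise it
was rejected for a small increment, and conditioning on later selections only lowers that. -/
theorem orbitEntropy_le_greedy (hT : Measurable T) (hA : MeasurableSet A) {c : ℝ} (hc : 0 ≤ c)
    {N : ℕ} {F : Finset ℕ} (hF : F ⊆ Finset.Icc 1 N) :
    orbitEntropy μ T A F ≤
      orbitEntropy μ T A (greedy (orbitEntropy μ T A) c N) + c * F.card := by
  have hm := measurable_label_iterate hT hA
  set E := orbitEntropy μ T A with hE
  set f : ℕ → X → Bool := fun i x => label A (T^[i] x)
  have h1 := jointEntropy_le_add_sum (μ := μ) hm (measurable_jointMap hm (greedy E c N)) F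
  rw [← jointEntropy_eq] at h1
  refine h1.trans (add_le_add le_rfl ?_)
  rw [mul_comm, ← nsmul_eq_mul]
  refine Finset.sum_le_card_nsmul _ _ _ fun i hi => ?_
  obtain ⟨hi1, hiN⟩ := Finset.mem_Icc.1 (hF hi)
  by_cases hg : i ∈ greedy E c N
  · rw [condEntropy_jointMap_eq hm, Finset.insert_eq_of_mem hg, sub_self]
    exact hc
  · obtain ⟨n, rfl⟩ : ∃ n, i = n + 1 := ⟨i - 1, by omega⟩
    have hsub : greedy E c n ⊆ greedy E c N := greedy_mono E c (by omega)
    refine (condEntropy_le_of_factor (hm (n + 1)) (measurable_jointMap hm _)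
      (measurable_jointMap hm (greedy E c n)) (fun y j => y ⟨j, hsub j.2⟩) fun x => rfl).trans ?_
    rw [condEntropy_jointMap_eq hm]
    exact insert_sub_le_of_notMem_greedy fun h => hg (mem_greedy_iff E c |>.2 ⟨hiN, h⟩)

theorem isSlow_of_upperEntropyDim_le (hT : Measurable T) (hA : MeasurableSet A) (hτ : 0 ≤ τ)
    (h : upperEntropyDim μ T (pairPartition A hA) ≤ ENNReal.ofReal τ) : IsSlow μ T A τ := by
  classical
  intro σ hσ c hc
  by_contra hcon
  have hσ0 : 0 < σ := hτ.trans_lt hσ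
  set E := orbitEntropy μ T A with hE
  -- A violating F leaves the greedy set with entropy above c N^σ; the factor 1/2 comes from the
  -- crude bound of `Fintype.card Bool` per index.
  have hcard : ∃ᶠ N : ℕ in atTop, c / 2 * (N : ℝ) ^ σ ≤ (greedy E c N).card := by
    refine (not_eventually.1 hcon).mono fun N hN => ?_
    push Not at hN
    obtain ⟨F, hF, hlt⟩ := hN
    have h1 := orbitEntropy_le_greedy (μ := μ) hT hA hc.le hF
    have h2 : E (greedy E c N) ≤ (greedy E c N).card * Fintype.card Bool :=
      jointEntropy_le_card_mul (measurable_label_iterate hT hA) _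
    rw [Fintype.card_bool] at h2
    push_cast at h2
    linarith
  set p : ℕ → Prop := fun m => m ∈ greedy E c m with hp
  have hgr : ∀ N, greedy E c N = (Finset.range (N + 1)).filter p := fun N => by
    ext m
    rw [mem_greedy_iff]
    simp [hp]
  have hcount : ∀ N, (greedy E c N).card = Nat.count p (N + 1) := fun N => by
    rw [hgr, Nat.count_eq_card_filter_range]
  have hinf : (Set.ofPred p).Infinite := by
    intro hfin
    have hlarge := (tendsto_const_mul_rpow_atTop hσ0 (half_pos hc)).eventually_gt_atTop
      (hfin.toFinset.card : ℝ)
    obtain ⟨N, h1, h2⟩ := (hcard.and_eventually hlarge).exists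
    have h3 : (greedy E c N).card ≤ hfin.toFinset.card := Finset.card_le_card fun m hm => by
      simpa using ((mem_greedy_iff E c).1 hm).2
    have : ((greedy E c N).card : ℝ) ≤ hfin.toFinset.card := by exact_mod_cast h3
    linarith
  set s := Nat.nth p with hs
  have hmono : StrictMono s := Nat.nth_strictMono hinf
  have hps : ∀ n, p (s n) := Nat.nth_mem_of_infinite hinf
  have himage : ∀ n, (Finset.range (n + 1)).image s = greedy E c (s n) := by
    intro n
    ext m
    rw [mem_greedy_iff, Finset.mem_image]
    constructor
    · rintro ⟨i, hi, rfl⟩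
      exact ⟨hmono.monotone (by simpa [Nat.lt_succ_iff] using hi), hps i⟩
    · rintro ⟨h1, h2⟩
      obtain ⟨i, rfl⟩ : m ∈ Set.range s := by
        rw [hs, Nat.range_nth_of_infinite hinf]
        exact h2
      exact ⟨i, by simpa [Nat.lt_succ_iff] using hmono.le_iff_le.1 h1, rfl⟩
  have hgen : s ∈ entropyGenerating μ T (pairPartition A hA) := by
    refine ⟨⟨hmono, (Finset.mem_Icc.1 (greedy_subset_Icc E c _ (hps 0))).1⟩, ?_⟩
    refine (ENNReal.ofReal_pos.2 hc).trans_le (le_liminf_of_le (by isBoundedDefault) ?_)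
    filter_upwards [eventually_gt_atTop 0] with n hn
    obtain ⟨m, rfl⟩ : ∃ m, n = m + 1 := ⟨n - 1, by omega⟩
    rw [joinEntropy_eq_orbitEntropy hT hA]
    refine ENNReal.ofReal_le_ofReal ((le_div_iff₀ (by positivity)).2 ?_)
    have h1 := mul_card_greedy_le (E := E) (jointEntropy_empty _) c (s m)
    rw [← himage, Finset.card_image_of_injective _ hmono.injective, Finset.card_range] at h1
    exact h1
  have hdim : ENNReal.ofReal σ ≤ upperDim s := by
    refine le_iInf₂ fun ρ hρ => ?_
    by_contra! hlt
    have hρσ : (ρ : ℝ) < σ := by simpa [ENNReal.lt_ofReal_iff_toReal_lt] using hlt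
    have hev : ∀ᶠ n : ℕ in atTop,
        ENNReal.ofReal (((n : ℝ) + 1) / (s n : ℝ) ^ (ρ : ℝ)) < 1 :=
      eventually_lt_of_limsup_lt (show upperDensityAt s ρ < 1 by simp [hρ]) (by isBoundedDefault)
    obtain ⟨M, hM⟩ := eventually_atTop.1 hev
    have h1 := (tendsto_const_mul_rpow_atTop hσ0 (half_pos hc)).eventually_gt_atTop ((M : ℝ) + 1)
    -- N is chosen so that the last selected index s m ≤ N has m ≥ M and m + 1 ≥ (c/2) N^σ > N^ρ ≥
    -- (s m)^ρ, contradicting the ratio bound.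
    have h2 := (tendsto_const_mul_rpow_atTop (sub_pos.2 hρσ) (half_pos hc)).eventually_gt_atTop 1
    obtain ⟨N, hN, hN1, hN2, hN0⟩ :=
      (hcard.and_eventually (h1.and (h2.and (eventually_gt_atTop 0)))).exists
    have hbig : M + 1 < (greedy E c N).card := by exact_mod_cast hN1.trans_le hN
    obtain ⟨m, hm⟩ : ∃ m, (greedy E c N).card = m + 1 := ⟨(greedy E c N).card - 1, by omega⟩
    have hsm : s m ≤ N := Nat.lt_succ_iff.1 (Nat.nth_lt_of_lt_count (by rw [← hcount, hm]; omega))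
    have hN0' : (0 : ℝ) < N := by exact_mod_cast hN0
    have hsm0 : (0 : ℝ) < s m := by
      exact_mod_cast (Finset.mem_Icc.1 (greedy_subset_Icc E c _ (hps m))).1
    have h3 := hM m (by omega)
    rw [ENNReal.ofReal_lt_one, div_lt_one (Real.rpow_pos_of_pos hsm0 _)] at h3
    have h4 : (s m : ℝ) ^ (ρ : ℝ) ≤ (N : ℝ) ^ (ρ : ℝ) :=
      Real.rpow_le_rpow hsm0.le (by exact_mod_cast hsm) ρ.2
    rw [hm] at hN
    push_cast at hN
    rw [Real.rpow_sub hN0', ← mul_div_assoc, lt_div_iff₀ (Real.rpow_pos_of_pos hN0' _)] at hN2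
    linarith
  have := hdim.trans ((le_iSup₂ (f := fun s _ => upperDim s) s hgen).trans h)
  exact absurd ((ENNReal.ofReal_le_ofReal_iff hτ).1 this) (not_le.2 hσ)

theorem mem_dimAlgebra_iff (hT : Measurable T) (hτ : 0 ≤ τ) :
    A ∈ dimAlgebra μ T τ ↔ MeasurableSet A ∧ IsSlow μ T A τ :=
  ⟨fun ⟨hA, h⟩ => ⟨hA, isSlow_of_upperEntropyDim_le hT hA hτ h⟩,
    fun ⟨hA, h⟩ => ⟨hA, upperEntropyDim_le_of_isSlow hT hA h⟩⟩

end Characterization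

/-! ### The σ-algebra property, preimages and powers -/

section Algebra

variable {X : Type*} [MeasurableSpace X] {μ : Measure X} [IsProbabilityMeasure μ] {T : X → X}
  {A B : Set X} {τ : ℝ}

theorem isSlow_empty : IsSlow μ T (∅ : Set X) τ := by
  classical
  intro σ _ c hc
  refine Eventually.of_forall fun N F _ => ?_
  have h1 : orbitEntropy μ T ∅ F ≤ entropy μ (fun _ : X => ()) := by
    rw [orbitEntropy, jointEntropy_eq]
    refine entropy_le_of_factor measurable_const (fun _ _ => false) fun x => ?_
    funext i
    simp [jointMap]
  have h2 : entropy μ (fun _ : X => ()) = 0 := by simp [entropy, Set.preimage]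
  rw [h2] at h1
  exact h1.trans (by positivity)

theorem IsSlow.compl (hT : Measurable T) (hA : MeasurableSet A) (h : IsSlow μ T A τ) :
    IsSlow μ T Aᶜ τ := by
  classical
  intro σ hσ c hc
  filter_upwards [h σ hσ c hc] with N hN F hF
  refine le_trans ?_ (hN F hF)
  rw [orbitEntropy, jointEntropy_eq, orbitEntropy, jointEntropy_eq]
  refine entropy_le_of_factor (measurable_jointMap (measurable_label_iterate hT hA) F)
    (fun y i => !(y i)) fun x => ?_
  funext i
  rw [Bool.eq_iff_iff]
  simp [jointMap]

theorem orbitEntropy_union_le (hT : Measurable T) (hA : MeasurableSet A) (hB : MeasurableSet B)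
    (F : Finset ℕ) :
    orbitEntropy μ T (A ∪ B) F ≤ orbitEntropy μ T A F + orbitEntropy μ T B F := by
  classical
  have hmA := measurable_jointMap (measurable_label_iterate hT hA) F
  have hmB := measurable_jointMap (measurable_label_iterate hT hB) F
  simp only [orbitEntropy, jointEntropy_eq]
  have h1 := entropy_le_of_factor (μ := μ) (hmA.prodMk hmB) (fun y i => y.1 i || y.2 i)
    (f := jointMap (fun i x => label (A ∪ B) (T^[i] x)) F) (fun x => by
      funext i
      rw [Bool.eq_iff_iff]
      simp [jointMap])
  have h2 := condEntropy_le_entropy (μ := μ) hmA hmB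
  unfold condEntropy at h2
  linarith

theorem IsSlow.union (hT : Measurable T) (hA : MeasurableSet A) (hB : MeasurableSet B)
    (h : IsSlow μ T A τ) (h' : IsSlow μ T B τ) : IsSlow μ T (A ∪ B) τ := by
  intro σ hσ c hc
  filter_upwards [h σ hσ (c / 2) (half_pos hc), h' σ hσ (c / 2) (half_pos hc)] with N h1 h2 F hF
  linarith [orbitEntropy_union_le (μ := μ) hT hA hB F, h1 F hF, h2 F hF]

/-- Given the whole itinerary of B, each T⁻ⁱA costs at most what it costs given T⁻ⁱB alone, and by
invariance that cost does not depend on i. -/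
theorem orbitEntropy_le_add_mul_condEntropy (hT : MeasurePreserving T μ μ) (hA : MeasurableSet A)
    (hB : MeasurableSet B) (F : Finset ℕ) :
    orbitEntropy μ T A F ≤
      orbitEntropy μ T B F + F.card * condEntropy μ (label A) (label B) := by
  classical
  have hmA := measurable_label_iterate hT.measurable hA
  have hmB := measurable_label_iterate hT.measurable hB
  have h1 := jointEntropy_le_add_sum (μ := μ) hmA (measurable_jointMap hmB F) F
  rw [← jointEntropy_eq] at h1
  refine h1.trans (add_le_add le_rfl ?_)
  rw [← nsmul_eq_mul]
  refine Finset.sum_le_card_nsmul _ _ _ fun i hi => ?_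
  have h2 := condEntropy_le_of_factor (μ := μ) (hmA i) (measurable_jointMap hmB F) (hmB i)
    (fun y => y ⟨i, hi⟩) fun x => rfl
  refine h2.trans (le_of_eq ?_)
  rw [condEntropy, condEntropy, ← entropy_comp_measurePreserving
    ((measurable_label hA).prodMk (measurable_label hB)) (hT.iterate i),
    ← entropy_comp_measurePreserving (measurable_label hB) (hT.iterate i)]

theorem isSlow_of_forall_condEntropy_le (hT : MeasurePreserving T μ μ) (hA : MeasurableSet A)
    (h : ∀ ε > 0, ∃ B, MeasurableSet B ∧ IsSlow μ T B τ ∧ condEntropy μ (label A) (label B) ≤ ε) :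
    IsSlow μ T A τ := by
  intro σ hσ c hc
  obtain ⟨B, hB, hslow, hle⟩ := h (c / 2) (half_pos hc)
  filter_upwards [hslow σ hσ (c / 2) (half_pos hc)] with N hN F hF
  have h1 := orbitEntropy_le_add_mul_condEntropy (μ := μ) hT hA hB F
  have h2 := mul_le_mul_of_nonneg_left hle (Nat.cast_nonneg (α := ℝ) F.card)
  have h3 : 0 ≤ c / 2 * (N : ℝ) ^ σ := by positivity
  linarith [hN F hF]

theorem condEntropy_label_of_subset (hA : MeasurableSet A) (hB : MeasurableSet B) (h : B ⊆ A) :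
    condEntropy μ (label A) (label B) = Real.negMulLog (μ.real A - μ.real B) +
      Real.negMulLog (1 - μ.real A) - Real.negMulLog (1 - μ.real B) := by
  have e1 : (fun x => (label A x, label B x)) ⁻¹' {(true, true)} = B := by
    ext x; simpa using fun hx => h hx
  have e2 : (fun x => (label A x, label B x)) ⁻¹' {(true, false)} = A \ B := by
    ext x; simp
  have e3 : (fun x => (label A x, label B x)) ⁻¹' {(false, true)} = ∅ := by
    ext x; simpa using fun hx hx' => hx (h hx')
  have e4 : (fun x => (label A x, label B x)) ⁻¹' {(false, false)} = Aᶜ := by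
    ext x; simpa using fun hx hx' => hx (h hx')
  have e5 : label B ⁻¹' {true} = B := by ext x; simp
  have e6 : label B ⁻¹' {false} = Bᶜ := by ext x; simp
  rw [condEntropy, entropy, entropy, Fintype.sum_prod_type]
  simp only [Fintype.sum_bool, e1, e2, e3, e4, e5, e6]
  rw [measureReal_sdiff h hB, probReal_compl_eq_one_sub hA, probReal_compl_eq_one_sub hB,
    measureReal_empty, Real.negMulLog_zero]
  ring

theorem isSlow_iUnion (hT : MeasurePreserving T μ μ) {f : ℕ → Set X}
    (hm : ∀ n, MeasurableSet (f n)) (h : ∀ n, IsSlow μ T (f n) τ) :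
    IsSlow μ T (⋃ n, f n) τ := by
  -- Increasing finite unions lie inside the limit, so the nested formula for the conditional
  -- entropy applies and tends to 0 by continuity.
  have hacc : ∀ n, MeasurableSet (Set.accumulate f n) ∧ IsSlow μ T (Set.accumulate f n) τ := by
    intro n
    induction n with
    | zero => simpa [Set.accumulate_def] using ⟨hm 0, h 0⟩
    | succ n ih =>
      rw [Set.accumulate_succ]
      exact ⟨ih.1.union (hm _), ih.2.union hT.measurable ih.1 (hm _) (h _)⟩
  refine isSlow_of_forall_condEntropy_le hT (MeasurableSet.iUnion hm) fun ε hε => ?_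
  have hlim : Tendsto (fun n => μ.real (Set.accumulate f n)) atTop (nhds (μ.real (⋃ n, f n))) :=
    (ENNReal.tendsto_toReal (measure_ne_top _ _)).comp tendsto_measure_iUnion_accumulate
  have hc := Real.continuous_negMulLog
  have hlim2 : Tendsto (fun n => condEntropy μ (label (⋃ n, f n)) (label (Set.accumulate f n)))
      atTop (nhds 0) := by
    have hsub : ∀ n, Set.accumulate f n ⊆ ⋃ n, f n := fun n => Set.accumulate_subset_iUnion n
    simp_rw [condEntropy_label_of_subset (MeasurableSet.iUnion hm) (hacc _).1 (hsub _)]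
    have h1 := (((hc.tendsto _).comp (hlim.const_sub (μ.real (⋃ n, f n)))).add_const
      (Real.negMulLog (1 - μ.real (⋃ n, f n)))).sub ((hc.tendsto _).comp (hlim.const_sub 1))
    simpa using h1
  obtain ⟨n, hn⟩ := (hlim2.eventually_lt_const hε).exists
  exact ⟨_, (hacc n).1, (hacc n).2, hn.le⟩

theorem isSubSigmaAlgebra_dimAlgebra (hT : MeasurePreserving T μ μ) (hτ : 0 ≤ τ) :
    IsSubSigmaAlgebra (dimAlgebra μ T τ) := by
  refine ⟨{ MeasurableSet' := fun A => MeasurableSet A ∧ IsSlow μ T A τ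
            measurableSet_empty := ⟨MeasurableSet.empty, isSlow_empty⟩
            measurableSet_compl := fun A h => ⟨h.1.compl, h.2.compl hT.measurable h.1⟩
            measurableSet_iUnion := fun f h => ⟨MeasurableSet.iUnion fun n => (h n).1,
              isSlow_iUnion hT (fun n => (h n).1) fun n => (h n).2⟩ },
    fun A h => h.1, fun A => (mem_dimAlgebra_iff hT.measurable hτ).symm⟩

theorem orbitEntropy_preimage (hT : MeasurePreserving T μ μ) (hA : MeasurableSet A)
    (F : Finset ℕ) : orbitEntropy μ T (T ⁻¹' A) F = orbitEntropy μ T A F := by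
  classical
  rw [← orbitEntropy_image_add hT hA 1, orbitEntropy, orbitEntropy,
    jointEntropy_image (measurable_label_iterate hT.measurable hA)]
  congr 1
  funext i x
  rw [Bool.eq_iff_iff]
  simp [Function.iterate_succ_apply']

theorem preimage_mem_dimAlgebra (hT : MeasurePreserving T μ μ) (hτ : 0 ≤ τ)
    (h : A ∈ dimAlgebra μ T τ) : T ⁻¹' A ∈ dimAlgebra μ T τ := by
  rw [mem_dimAlgebra_iff hT.measurable hτ] at h ⊢
  refine ⟨hT.measurable h.1, fun σ hσ c hc => ?_⟩
  filter_upwards [h.2 σ hσ c hc] with N hN F hF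
  rw [orbitEntropy_preimage hT h.1]
  exact hN F hF

/-- Admits the time 0, which residue classes and reflections produce: shift F by one and absorb (N +
1)^σ ≤ 2^σ N^σ into the constant. -/
theorem IsSlow.eventually_range (hT : MeasurePreserving T μ μ) (hA : MeasurableSet A)
    (hτ : 0 ≤ τ) (h : IsSlow μ T A τ) {σ : ℝ} (hσ : τ < σ) {c : ℝ} (hc : 0 < c) :
    ∀ᶠ N : ℕ in atTop, ∀ F ⊆ Finset.range (N + 1),
      orbitEntropy μ T A F ≤ c * (F.card + (N : ℝ) ^ σ) := by
  have hσ0 : 0 < σ := hτ.trans_lt hσ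
  have h1 : (1 : ℝ) ≤ 2 ^ σ := Real.one_le_rpow one_le_two hσ0.le
  filter_upwards [(tendsto_add_atTop_nat 1).eventually (h σ hσ (c / 2 ^ σ) (by positivity)),
    eventually_gt_atTop 0] with N hN hN0 F hF
  have h2 := hN (F.image (· + 1)) (by
    intro m hm
    obtain ⟨i, hi, rfl⟩ := Finset.mem_image.1 hm
    have := Finset.mem_range.1 (hF hi)
    simp only [Finset.mem_Icc]
    omega)
  rw [orbitEntropy_image_add hT hA, Finset.card_image_of_injective _ (add_left_injective 1)] at h2
  have h3 : ((N + 1 : ℕ) : ℝ) ^ σ ≤ 2 ^ σ * (N : ℝ) ^ σ := by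
    rw [← Real.mul_rpow two_pos.le (Nat.cast_nonneg N)]
    refine Real.rpow_le_rpow (by positivity) ?_ hσ0.le
    have : (1 : ℝ) ≤ N := by exact_mod_cast hN0
    push_cast
    linarith
  refine h2.trans ?_
  rw [div_mul_eq_mul_div, div_le_iff₀ (by positivity)]
  have h4 : (F.card : ℝ) ≤ 2 ^ σ * F.card := le_mul_of_one_le_left (Nat.cast_nonneg _) h1
  have := mul_le_mul_of_nonneg_left (add_le_add h4 h3) hc.le
  linarith

theorem orbitEntropy_iterate (hT : Measurable T) (hA : MeasurableSet A) (k : ℕ) (F : Finset ℕ) :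
    orbitEntropy μ (T^[k]) A F = orbitEntropy μ T A (F.image (k * ·)) := by
  classical
  rw [orbitEntropy, orbitEntropy, jointEntropy_image (measurable_label_iterate hT hA)]
  simp only [Function.iterate_mul]

theorem IsSlow.iterate (hT : Measurable T) (hA : MeasurableSet A) {k : ℕ}
    (hk : 1 ≤ k) (hτ : 0 ≤ τ) (h : IsSlow μ T A τ) : IsSlow μ (T^[k]) A τ := by
  intro σ hσ c hc
  have hσ0 : 0 < σ := hτ.trans_lt hσ
  have hk0 : (1 : ℝ) ≤ k := by exact_mod_cast hk
  have h1 : (1 : ℝ) ≤ (k : ℝ) ^ σ := Real.one_le_rpow hk0 hσ0.le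
  have hk' : Tendsto (fun N : ℕ => k * N) atTop atTop :=
    tendsto_id.const_mul_atTop' (by omega)
  filter_upwards [hk'.eventually (h σ hσ (c / (k : ℝ) ^ σ) (by positivity))] with N hN F hF
  have h2 := hN (F.image (k * ·)) (by
    intro m hm
    obtain ⟨i, hi, rfl⟩ := Finset.mem_image.1 hm
    obtain ⟨hi1, hi2⟩ := Finset.mem_Icc.1 (hF hi)
    exact Finset.mem_Icc.2 ⟨Nat.mul_pos hk hi1, Nat.mul_le_mul_left k hi2⟩)
  rw [← orbitEntropy_iterate hT hA, Finset.card_image_of_injective _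
    (fun a b hab => Nat.eq_of_mul_eq_mul_left hk hab), Nat.cast_mul, Real.mul_rpow (by positivity)
    (by positivity)] at h2
  refine h2.trans ?_
  rw [div_mul_eq_mul_div, div_le_iff₀ (by positivity)]
  have h4 : (F.card : ℝ) ≤ (k : ℝ) ^ σ * F.card := le_mul_of_one_le_left (Nat.cast_nonneg _) h1
  have := mul_le_mul_of_nonneg_left (add_le_add h4 (le_refl ((k : ℝ) ^ σ * (N : ℝ) ^ σ))) hc.le
  linarith

/-- Split F into residue classes mod k; up to a shift, each is k times a set of times for T^k.
Bounding each class by the full |F| is harmless, since c/k is used for each of the k classes. -/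
theorem IsSlow.of_iterate (hT : MeasurePreserving T μ μ) (hA : MeasurableSet A) {k : ℕ}
    (hk : 1 ≤ k) (hτ : 0 ≤ τ) (h : IsSlow μ (T^[k]) A τ) : IsSlow μ T A τ := by
  intro σ hσ c hc
  have hk0 : (0 : ℝ) < k := by exact_mod_cast hk
  filter_upwards [h.eventually_range (hT.iterate k) hA hτ hσ (div_pos hc hk0)] with N hN F hF
  set G : ℕ → Finset ℕ := fun r => (F.filter (· % k = r)).image (· / k) with hG
  have hcover : F ⊆ (Finset.range k).biUnion fun r => ((G r).image (k * ·)).image (· + r) := by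
    intro m hm
    simp only [Finset.mem_biUnion, Finset.mem_range, Finset.mem_image, hG, Finset.mem_filter]
    exact ⟨m % k, Nat.mod_lt _ hk, k * (m / k), ⟨m / k, ⟨m, ⟨hm, rfl⟩, rfl⟩, rfl⟩,
      Nat.div_add_mod m k⟩
  have hmT := measurable_label_iterate hT.measurable hA
  have h1 : orbitEntropy μ T A F ≤
      ∑ r ∈ Finset.range k, orbitEntropy μ T A (((G r).image (k * ·)).image (· + r)) :=
    (jointEntropy_mono hmT hcover).trans (jointEntropy_biUnion_le hmT _ _)
  refine h1.trans ?_
  have h2 : ∀ r ∈ Finset.range k, orbitEntropy μ T A (((G r).image (k * ·)).image (· + r)) ≤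
      c / k * (F.card + (N : ℝ) ^ σ) := by
    intro r _
    rw [orbitEntropy_image_add hT hA, ← orbitEntropy_iterate hT.measurable hA]
    refine (hN (G r) ?_).trans ?_
    · intro m hm
      obtain ⟨i, hi, rfl⟩ := Finset.mem_image.1 hm
      have h3 := (Finset.mem_Icc.1 (hF (Finset.mem_filter.1 hi).1)).2
      have h4 := Nat.div_le_self i k
      exact Finset.mem_range.2 (by omega)
    · have : (G r).card ≤ F.card := Finset.card_image_le.trans (Finset.card_filter_le _ _)
      gcongr
  refine (Finset.sum_le_card_nsmul _ _ _ h2).trans (le_of_eq ?_)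
  rw [Finset.card_range, nsmul_eq_mul]
  field_simp

theorem dimAlgebra_iterate (hT : MeasurePreserving T μ μ) (hτ : 0 ≤ τ) {k : ℕ} (hk : 1 ≤ k) :
    dimAlgebra μ T τ = dimAlgebra μ (T^[k]) τ := by
  ext A
  rw [mem_dimAlgebra_iff hT.measurable hτ, mem_dimAlgebra_iff (hT.iterate k).measurable hτ]
  exact and_congr_right fun hA =>
    ⟨fun h => h.iterate hT.measurable hA hk hτ, fun h => h.of_iterate hT hA hk hτ⟩

end Algebra

/-! ### Inverse transformations -/

section Inverse

variable {X : Type*} [MeasurableSpace X] {μ : Measure X} {T S : X → X} {A : Set X} {τ : ℝ}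

theorem measurePreserving_of_comp_ae_eq_id (hT : MeasurePreserving T μ μ) (hS : Measurable S)
    (h : S ∘ T =ᵐ[μ] id) : MeasurePreserving S μ μ := by
  refine ⟨hS, ?_⟩
  calc μ.map S = (μ.map T).map S := by rw [hT.map_eq]
    _ = μ.map (S ∘ T) := Measure.map_map hS hT.measurable
    _ = μ := by rw [Measure.map_congr h, Measure.map_id]

theorem ae_iterate_iterate_eq (hT : MeasurePreserving T μ μ) (h : S ∘ T =ᵐ[μ] id) :
    ∀ᵐ x ∂μ, ∀ i N : ℕ, i ≤ N → S^[i] (T^[N] x) = T^[N - i] x := by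
  have h1 : ∀ᵐ x ∂μ, ∀ j : ℕ, S (T (T^[j] x)) = T^[j] x :=
    ae_all_iff.2 fun j => (hT.iterate j).quasiMeasurePreserving.ae h
  filter_upwards [h1] with x hx i
  induction i with
  | zero => intro N _; rfl
  | succ i ih =>
    intro N hN
    obtain ⟨N, rfl⟩ : ∃ M, N = M + 1 := ⟨N - 1, by omega⟩
    rw [Function.iterate_succ_apply, Function.iterate_succ_apply' T, hx, ih N (by omega),
      Nat.add_sub_add_right]

variable [IsProbabilityMeasure μ]

/-- Pull back by T^N, which preserves entropy and turns S^i into T^(N - i) almost everywhere. -/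
theorem orbitEntropy_inverse (hT : MeasurePreserving T μ μ) (hS : Measurable S)
    (h : S ∘ T =ᵐ[μ] id) (hA : MeasurableSet A) {N : ℕ} {F : Finset ℕ}
    (hF : F ⊆ Finset.Icc 1 N) :
    orbitEntropy μ S A F = orbitEntropy μ T A (F.image (N - ·)) := by
  classical
  rw [orbitEntropy, orbitEntropy, jointEntropy_image (measurable_label_iterate hT.measurable hA),
    jointEntropy_eq, jointEntropy_eq, ← entropy_comp_measurePreserving
      (measurable_jointMap (measurable_label_iterate hS hA) F) (hT.iterate N)]
  refine entropy_congr ?_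
  filter_upwards [ae_iterate_iterate_eq hT h] with x hx
  funext i
  simp only [jointMap]
  rw [hx i N (Finset.mem_Icc.1 (hF i.2)).2]

theorem IsSlow.inverse (hT : MeasurePreserving T μ μ) (hS : Measurable S)
    (hST : S ∘ T =ᵐ[μ] id) (hA : MeasurableSet A) (hτ : 0 ≤ τ) (h : IsSlow μ T A τ) :
    IsSlow μ S A τ := by
  intro σ hσ c hc
  filter_upwards [h.eventually_range hT hA hτ hσ hc] with N hN F hF
  rw [orbitEntropy_inverse hT hS hST hA hF]
  refine (hN _ ?_).trans ?_
  · intro m hm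
    obtain ⟨i, _, rfl⟩ := Finset.mem_image.1 hm
    exact Finset.mem_range.2 (by omega)
  · have : (F.image (N - ·)).card ≤ F.card := Finset.card_image_le
    gcongr

theorem dimAlgebra_inverse (hT : MeasurePreserving T μ μ) (hS : Measurable S)
    (hST : S ∘ T =ᵐ[μ] id) (hTS : T ∘ S =ᵐ[μ] id) (hτ : 0 ≤ τ) :
    dimAlgebra μ T τ = dimAlgebra μ S τ := by
  have hS' := measurePreserving_of_comp_ae_eq_id hT hS hST
  ext A
  rw [mem_dimAlgebra_iff hT.measurable hτ, mem_dimAlgebra_iff hS hτ]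
  exact and_congr_right fun hA =>
    ⟨fun h => h.inverse hT hS hST hA hτ, fun h => h.inverse hS' hT.measurable hTS hA hτ⟩

end Inverse

/-! ### Surjectivity of the preimage map modulo μ -/

section Preimage

variable {X : Type*} [MeasurableSpace X] {μ : Measure X} [IsProbabilityMeasure μ] {T : X → X}
  {A : Set X} {τ : ℝ}

/-- `W` is the majority guess: on each cell of g the error is the smaller of the two masses,
controlled by `min_le_negMulLog_add`. -/
theorem exists_measureReal_symmDiff_le_condEntropy (hA : MeasurableSet A) {ξ : Type*} [Fintype ξ]
    [MeasurableSpace ξ] [MeasurableSingletonClass ξ] {g : X → ξ} (hg : Measurable g) :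
    ∃ W : Set ξ, μ.real (symmDiff A (g ⁻¹' W)) ≤ condEntropy μ (label A) g := by
  classical
  set p : Bool → ξ → ℝ := fun b w => μ.real ((fun x => (label A x, g x)) ⁻¹' {(b, w)}) with hp
  have hm := (measurable_label hA).prodMk hg
  have h1 : ∀ w, μ.real (g ⁻¹' {w}) = p true w + p false w := by
    intro w
    rw [hp, ← measureReal_union]
    · congr 1
      ext x
      cases hx : label A x <;> simp [hx]
    · exact Disjoint.preimage _ (by simp)
    · exact hm (measurableSet_singleton _)
  have h2 : condEntropy μ (label A) g = ∑ w, (Real.negMulLog (p true w) +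
      Real.negMulLog (p false w) - Real.negMulLog (p true w + p false w)) := by
    rw [condEntropy, entropy, entropy, Fintype.sum_prod_type, Fintype.sum_bool,
      ← Finset.sum_add_distrib, ← Finset.sum_sub_distrib]
    simp only [h1, hp]
  set W : Set ξ := {w | p false w ≤ p true w} with hW
  refine ⟨W, ?_⟩
  have h3 : symmDiff A (g ⁻¹' W) ⊆
      ⋃ w, (fun x => (label A x, g x)) ⁻¹' {(decide (w ∉ W), w)} := by
    intro x hx
    refine Set.mem_iUnion.2 ⟨g x, ?_⟩
    rcases hx with ⟨ha, hb⟩ | ⟨hb, ha⟩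
    · have : g x ∉ W := hb
      simp [this, ha]
    · have : g x ∈ W := hb
      simp [this, ha]
  rw [h2]
  refine (measureReal_mono h3).trans ((measureReal_iUnion_fintype_le _).trans
    (Finset.sum_le_sum fun w _ => ?_))
  refine le_trans (le_of_eq ?_)
    (min_le_negMulLog_add (measureReal_nonneg (μ := μ)) measureReal_nonneg)
  by_cases h : w ∈ W
  · rw [min_eq_right h]
    simp [h, hp]
  · rw [min_eq_left (le_of_lt (not_le.1 h))]
    simp [h, hp]

theorem exists_condEntropy_past_le (hT : MeasurePreserving T μ μ) (hA : MeasurableSet A)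
    (hτ0 : 0 ≤ τ) (hτ : τ < 1) (h : IsSlow μ T A τ) {ε : ℝ} (hε : 0 < ε) :
    ∃ n : ℕ, condEntropy μ (label A)
      (fun x => jointMap (fun i x => label A (T^[i] x)) (Finset.range n) (T x)) ≤ ε := by
  classical
  have hm := measurable_label_iterate hT.measurable hA
  set f : ℕ → X → Bool := fun i x => label A (T^[i] x) with hf
  have key : ∀ n : ℕ, condEntropy μ (label A) (fun x => jointMap f (Finset.range n) (T x)) =
      orbitEntropy μ T A (Finset.range (n + 1)) - orbitEntropy μ T A (Finset.range n) := by
    intro n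
    have hn := measurable_jointMap hm (Finset.range n)
    rw [condEntropy, entropy_comp_measurePreserving hn hT, orbitEntropy, orbitEntropy,
      jointEntropy_eq, jointEntropy_eq]
    congr 1
    refine entropy_eq_of_factor ((measurable_label hA).prodMk (hn.comp hT.measurable))
      (measurable_jointMap hm _)
      (fun y => (y ⟨0, by simp⟩, fun i => y ⟨i + 1, Finset.mem_range.2 (Nat.succ_lt_succ (Finset.mem_range.1 i.2))⟩))
      (fun y i => if hi : (i : ℕ) = 0 then y.1 else
        y.2 ⟨i - 1, by have := Finset.mem_range.1 i.2; exact Finset.mem_range.2 (by omega)⟩)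
      (fun x => rfl) fun x => ?_
    funext ⟨i, hi⟩
    rcases i with _ | i
    · simp [jointMap]
    · simp [jointMap, hf]
  by_contra! hcon
  have hgrow : ∀ n : ℕ, ε * n ≤ orbitEntropy μ T A (Finset.range n) := by
    intro n
    induction n with
    | zero =>
      rw [Nat.cast_zero, mul_zero]
      exact (jointEntropy_empty (μ := μ) f).ge
    | succ n ih =>
      have := hcon n
      rw [key] at this
      push_cast
      linarith
  -- As τ < 1, the exponent σ = 1 is allowed; with c = ε/4 the bound is about εN/2, against growth
  -- of at least εN.
  obtain ⟨N, hN, hN0⟩ := ((h.eventually_range hT hA hτ0 hτ (c := ε / 4) (by positivity)).and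
    (eventually_gt_atTop 0)).exists
  have h1 := hN (Finset.range N) (Finset.range_subset_range.2 N.le_succ)
  rw [Finset.card_range, Real.rpow_one] at h1
  have h2 : 0 < ε * N := mul_pos hε (by exact_mod_cast hN0)
  linarith [hgrow N]

theorem iterate_preimage_mem_dimAlgebra (hT : MeasurePreserving T μ μ) (hτ : 0 ≤ τ)
    (h : A ∈ dimAlgebra μ T τ) (i : ℕ) : T^[i] ⁻¹' A ∈ dimAlgebra μ T τ := by
  induction i with
  | zero => exact h
  | succ i ih =>
    rw [Function.iterate_succ, Set.preimage_comp]
    exact preimage_mem_dimAlgebra hT hτ ih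

theorem jointMap_preimage_mem_dimAlgebra (hT : MeasurePreserving T μ μ) (hτ : 0 ≤ τ)
    (h : A ∈ dimAlgebra μ T τ) (F : Finset ℕ) (W : Set (F → Bool)) :
    jointMap (fun i x => label A (T^[i] x)) F ⁻¹' W ∈ dimAlgebra μ T τ := by
  have hi := iterate_preimage_mem_dimAlgebra hT hτ h
  obtain ⟨P, -, hP⟩ := isSubSigmaAlgebra_dimAlgebra hT hτ
  -- Measurability here is with respect to `P`, not the ambient σ-algebra.
  refine (hP _).1 ((measurable_jointMap (fun i => measurable_to_bool ?_) F)
    (Set.toFinite W).measurableSet)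
  convert (hP _).2 (hi i) using 1
  ext x
  simp

theorem limsup_mem_dimAlgebra (hT : MeasurePreserving T μ μ) (hτ : 0 ≤ τ) {C : ℕ → Set X}
    (h : ∀ n, C n ∈ dimAlgebra μ T τ) : limsup C atTop ∈ dimAlgebra μ T τ := by
  obtain ⟨P, -, hP⟩ := isSubSigmaAlgebra_dimAlgebra hT hτ
  exact (hP _).1 (MeasurableSet.measurableSet_limsup fun n => (hP _).2 (h n))

theorem exists_preimage_ae_eq (hT : MeasurePreserving T μ μ) (hτ0 : 0 ≤ τ) (hτ : τ < 1)
    (h : A ∈ dimAlgebra μ T τ) : ∃ D ∈ dimAlgebra μ T τ, A =ᵐ[μ] T ⁻¹' D := by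
  obtain ⟨hA, hslow⟩ := (mem_dimAlgebra_iff hT.measurable hτ0).1 h
  have hm := measurable_label_iterate hT.measurable hA
  set f : ℕ → X → Bool := fun i x => label A (T^[i] x) with hf
  have happrox : ∀ k : ℕ, ∃ C ∈ dimAlgebra μ T τ,
      -- Geometric errors are summable, as Borel–Cantelli requires.
      μ (symmDiff A (T ⁻¹' C)) ≤ ENNReal.ofReal ((1 / 2) ^ k) := by
    intro k
    obtain ⟨n, hn⟩ := exists_condEntropy_past_le hT hA hτ0 hτ hslow
      (ε := (1 / 2) ^ k) (by positivity)
    obtain ⟨W, hW⟩ := exists_measureReal_symmDiff_le_condEntropy (μ := μ) hA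
      ((measurable_jointMap hm (Finset.range n)).comp hT.measurable)
    refine ⟨jointMap f (Finset.range n) ⁻¹' W, 
      jointMap_preimage_mem_dimAlgebra hT hτ0 h _ W, ?_⟩
    rw [← ofReal_measureReal]
    exact ENNReal.ofReal_le_ofReal (hW.trans hn)
  choose C hC hCle using happrox
  refine ⟨limsup C atTop, limsup_mem_dimAlgebra hT hτ0 hC, ?_⟩
  have hsum : ∑' k, μ (symmDiff A (T ⁻¹' C k)) ≠ ∞ := by
    refine ne_top_of_le_ne_top ?_ (ENNReal.tsum_le_tsum hCle)
    rw [← ENNReal.ofReal_tsum_of_nonneg (fun _ => by positivity) summable_geometric_two]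
    exact ENNReal.ofReal_ne_top
  filter_upwards [ae_eventually_notMem hsum] with x hx
  refine propext ?_
  change x ∈ A ↔ T x ∈ limsup C atTop
  rw [mem_limsup_iff_frequently_mem]
  -- For almost every x, membership of T x in C k eventually agrees with x ∈ A, so the limsup
  -- decides it correctly.
  have hev : ∀ᶠ k in atTop, (x ∈ A ↔ T x ∈ C k) := hx.mono fun k hk => by
    rw [Set.mem_symmDiff] at hk
    simp only [Set.mem_preimage] at hk
    tauto
  rw [← frequently_congr hev, frequently_const]

end Preimage

end EntropyDim

end

theorem mainTheorem8 {X : Type*} [MeasurableSpace X] (μ : Measure X) [IsProbabilityMeasure μ]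
    (T : X → X) (hT : MeasurePreserving T μ μ) (τ : ℝ) (hτ : τ ∈ Set.Ico (0 : ℝ) 1) :
    EntropyDim.IsSubSigmaAlgebra (EntropyDim.dimAlgebra μ T τ) ∧
    EntropyDim.EqMod μ ((fun A : Set X => T ⁻¹' A) '' EntropyDim.dimAlgebra μ T τ)
      (EntropyDim.dimAlgebra μ T τ) ∧
    (∀ k : ℕ, 1 ≤ k → EntropyDim.dimAlgebra μ T τ = EntropyDim.dimAlgebra μ (T^[k]) τ) ∧
    (∀ S : X → X, Measurable S → S ∘ T =ᵐ[μ] id → T ∘ S =ᵐ[μ] id →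
      EntropyDim.dimAlgebra μ T τ = EntropyDim.dimAlgebra μ S τ) := by
  refine ⟨EntropyDim.isSubSigmaAlgebra_dimAlgebra hT hτ.1, ⟨?_, ?_⟩,
    fun k hk => EntropyDim.dimAlgebra_iterate hT hτ.1 hk,
    fun S hS hST hTS => EntropyDim.dimAlgebra_inverse hT hS hST hTS hτ.1⟩
  · rintro _ ⟨A, hA, rfl⟩
    exact ⟨_, EntropyDim.preimage_mem_dimAlgebra hT hτ.1 hA, ae_eq_refl _⟩
  · intro B hB
    obtain ⟨D, hD, hBD⟩ := EntropyDim.exists_preimage_ae_eq hT hτ.1 hτ.2 hB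
    exact ⟨_, ⟨D, hD, rfl⟩, hBD⟩
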